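/- Let $n_1,\dots,n_k$ ($k\ge 1$) be non-zero integers such that the Conway diagram $K=C[n_1,\dots,n_k]$ is a diagram of a (2-bridge) knot, and orient it. The diagram is read from top to bottom as four strands in positions $1,2,3,4$ from left to right: at the top the strands $1,2$ are joined by one bridge and $3,4$ by another; the $i$-th block consists of $|n_i|$ half twists of the strands $2,3$ if $i$ is odd and of the strands $1,2$ if $i$ is even, right-handed if $(-1)^{i+1}n_i>0$ and left-handed otherwise; at the bottom the strands are joined as $1,2$ and $3,4$ if $k$ is odd, and as $1,4$ and $2,3$ if $k$ is even. Let $\langle x,y\rangle=x_1y_2-x_2y_1$. Color the arcs by vectors, starting with $a=(1,0)$ on the left bridge and $b=(0,u)$ on the right bridge, and descending as follows: if $(x,y)$ are the vectors on the two strands above a crossing, those below it are $(y,\,-x-\delta\langle x,y\rangle y)$ at a right-handed crossing (where the right strand passes over), and $(-y-\delta\langle x,y\rangle x,\,x)$ at a left-handed crossing (where the left strand passes over), with $\delta=1$ if the over-strand is directed downward and $\delta=-1$ if it is directed upward. Let $u_i(u)\in\mathbb Z[u]$ be the determinant $\langle a_{i,0},b_{i,0}\rangle$ of the two vectors (left,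 right) entering the $i$-th block (so $u_1=u$). The rep-polynomial $P_K(u)\in\mathbb Z[u]$ is $\pm\langle z,b\rangle$, where $z$ is the vector at the bottom of strand $3$ if $k$ is odd and of strand $1$ if $k$ is even, with the sign that makes the leading coefficient positive. The parabolic representation $\rho_r:G(K)\to SL(2,\mathbb C)$ of the knot group corresponding to a root $r\in\mathbb C$ of $P_K$ sends the Wirtinger generator of each oriented arc to $\begin{pmatrix}1-x_1x_2&x_1^2\\-x_2^2&1+x_1x_2\end{pmatrix}$, where $(x_1,x_2)$ is the vector of that arc at $u=r$. Its trace field is $\mathbb Q(\operatorname{tr}\rho_r(\gamma)\mid\gamma\in G(K))$. Let $r\in\mathbb C$ be a non-zero root of $P_K(u)$. Then $$\mathbb Q(r)=\mathbb Q(u_k(r)).$$ Moreover, let $K'=C[(-1)^{k+1}n_k,\dots,(-1)^{k+1}n_1]$ be the upside-down diagram, with any orientation. Then $u_k(r)$ is a non-zero root of $P_{K'}$, the representations $\rho_r$ of $G(K)$ and $\rho'_{u_k(r)}$ of $G(K')$ exist, and they have the same trace field. -/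

import Mathlib

open Polynomial IntermediateField

noncomputable section

namespace TwoBridge

/-! ### Conway diagrams

A Conway diagram is read from top to bottom as a four-strand braid-like word.
The strands meeting a horizontal line are numbered `0, 1, 2, 3` from left to right
(these are `x, y, z, w`). -/

/-- A crossing between the strands at the adjacent positions `left` and `left + 1`.
If `right = true` the strand running from upper right to lower left passes over
(a right-handed half twist), otherwise the strand running from upper left to lower right
passes over (a left-handed half twist). -/
structure Crossing where
  left : Fin 3
  right : Bool

/-- The position of the left strand of a crossing. -/
def Crossing.l (c : Crossing) : Fin 4 := c.left.castSucc

/-- The position of the right strand of a crossing. -/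
def Crossing.r (c : Crossing) : Fin 4 := c.left.succ

/-- The permutation of the positions performed by a crossing. -/
def Crossing.swap (c : Crossing) : Equiv.Perm (Fin 4) := Equiv.swap c.l c.r

/-- The left position of the twist block with 0-based index `i`: the 1st, 3rd, 5th, ... blocks
twist the two middle strands, the 2nd, 4th, ... blocks twist the two leftmost strands. -/
def blockPos (i : ℕ) : Fin 3 := if Even i then 1 else 0

/-- The block with 0-based index `i` and Conway number `n`: `|n|` crossings, which are
right-handed iff `(-1)^i * n > 0`. -/
def block (i : ℕ) (n : ℤ) : List Crossing :=
  List.replicate n.natAbs ⟨blockPos i, decide (0 < (-1) ^ i * n)⟩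

/-- The crossings, from top to bottom, of consecutive blocks, the first one having index `i`. -/
def wordFrom : ℕ → List ℤ → List Crossing
  | _, [] => []
  | i, n :: ns => block i n ++ wordFrom (i + 1) ns

/-- The crossings of the diagram `C[n₁, …, n_k]` from top to bottom. -/
def word (ns : List ℤ) : List Crossing := wordFrom 0 ns

/-- At the top, the strands `0, 1` and the strands `2, 3` are joined by the two bridges. -/
def topCap : Equiv.Perm (Fin 4) := Equiv.swap 0 1 * Equiv.swap 2 3

/-- At the bottom of a diagram with `k` blocks, the strands are joined as `0, 1` and `2, 3` if
`k` is odd, and as `0, 3` and `1, 2` if `k` is even. -/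
def bottomCap (k : ℕ) : Equiv.Perm (Fin 4) :=
  if Odd k then Equiv.swap 0 1 * Equiv.swap 2 3 else Equiv.swap 0 3 * Equiv.swap 1 2

/-- The strand that arrives at position `s` below the crossings in `w` starts at the top at
position `strandPerm w s`. -/
def strandPerm (w : List Crossing) : Equiv.Perm (Fin 4) := (w.map Crossing.swap).prod

/-- The diagram `C[n₁, …, n_k]` is a knot diagram, i.e. it has only one component: the top and
bottom arcs join the four strands (labelled by their top positions) transitively. -/
def IsKnot (ns : List ℤ) : Prop :=
  MulAction.IsPretransitive
    (Subgroup.closure {topCap, strandPerm (word ns) * bottomCap ns.length *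
      (strandPerm (word ns))⁻¹}) (Fin 4)

/-- The upside-down diagram `C[(-1)^(k+1) n_k, …, (-1)^(k+1) n₁]` of `C[n₁, …, n_k]`. -/
def upsideDown (ns : List ℤ) : List ℤ :=
  ns.reverse.map fun n => (-1) ^ (ns.length + 1) * n

/-! ### Orientations -/

/-- An orientation of the diagram, given by the directions (`1` for downward, `-1` for upward) of
the four strands at the top: directions are carried along the strands, and the two ends joined by
an arc at the top or at the bottom have opposite vertical directions. -/
def IsOrientation (ns : List ℤ) (o : Fin 4 → ℤˣ) : Prop :=
  (∀ s, o (topCap s) = -o s) ∧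
    ∀ s, o (strandPerm (word ns) (bottomCap ns.length s)) = -o (strandPerm (word ns) s)

/-! ### Arc colorings by vectors -/

section Coloring

variable {R : Type*} [CommRing R]

/-- The symplectic form `⟨x, y⟩ = x₁ y₂ - x₂ y₁`. -/
def form (x y : Fin 2 → R) : R := x 0 * y 1 - x 1 * y 0

/-- The effect of a crossing on the four arc vectors, where `d` are the directions of the strands
above the crossing. For the strands `(a, b)` above it, the strands below it are
`(b, -(a ▷ b)) = (b, -a - ⟨a, b⟩ b)` if the strand `b` passes over and is directed downward, with
`▷` replaced by its inverse if `b` is directed upward; if `a` passes over, the inverse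
operation is performed. -/
def Crossing.color (c : Crossing) (d : Fin 4 → ℤˣ) (v : Fin 4 → Fin 2 → R) :
    Fin 4 → Fin 2 → R :=
  if c.right then
    Function.update (Function.update v c.l (v c.r)) c.r
      (-v c.l - (((d c.r : ℤ) : R) * form (v c.l) (v c.r)) • v c.r)
  else
    Function.update (Function.update v c.r (v c.l)) c.l
      (-v c.r - (((d c.l : ℤ) : R) * form (v c.l) (v c.r)) • v c.l)

/-- The arc vectors below the crossings in a word, from the directions and vectors above it. -/
def colorAfter : List Crossing → (Fin 4 → ℤˣ) → (Fin 4 → Fin 2 → R) → Fin 4 → Fin 2 → R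
  | [], _, v => v
  | c :: w, d, v => colorAfter w (fun s => d (c.swap s)) (c.color d v)

/-- The arc vectors at the top: the two bridges carry `a = (1, 0)` and `b = (0, u)`, so that
`⟨a, b⟩ = u`. -/
def topColor (u : R) : Fin 4 → Fin 2 → R := ![![1, 0], ![1, 0], ![0, u], ![0, u]]

end Coloring

/-- The polynomial `u_i` (`1 ≤ i ≤ k`) of the oriented diagram `C[n₁, …, n_k]`: the determinant
`⟨a_{i,0}, b_{i,0}⟩` of the two arc vectors entering the `i`-th block. -/
def uSeq (ns : List ℤ) (o : Fin 4 → ℤˣ) (i : ℕ) : ℤ[X] :=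
  let v := colorAfter (word (ns.take (i - 1))) o (topColor (X : ℤ[X]))
  form (v (blockPos (i - 1)).castSucc) (v (blockPos (i - 1)).succ)

/-- The determinant `⟨b_{k,f}, b⟩` (`k` odd), resp. `⟨a_{k,f}, b⟩` (`k` even), at the bottom;
here `b` is the vector of the rightmost strand. -/
def closingDet (ns : List ℤ) (o : Fin 4 → ℤˣ) : ℤ[X] :=
  let v := colorAfter (word ns) o (topColor (X : ℤ[X]))
  if Odd ns.length then form (v 2) (v 3) else form (v 0) (v 3)

/-- The rep-polynomial `P_K(u)`: the closing determinant, with its sign changed if necessary to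
make the leading coefficient positive. -/
def repPoly (ns : List ℤ) (o : Fin 4 → ℤˣ) : ℤ[X] :=
  C (SignType.sign (closingDet ns o).leadingCoeff : ℤ) * closingDet ns o

/-! ### The knot group and its parabolic representations -/

/-- The effect of a crossing on the Wirtinger generators of the four strands above it, the
directions of which are `d`: the strand that passes under is conjugated. -/
def Crossing.conj {G : Type*} [Group G] (c : Crossing) (d : Fin 4 → ℤˣ) (g : Fin 4 → G) :
    Fin 4 → G :=
  if c.right then
    Function.update (Function.update g c.l (g c.r)) c.r
      (g c.r ^ (-(d c.r : ℤ)) * g c.l * g c.r ^ (d c.r : ℤ))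
  else
    Function.update (Function.update g c.r (g c.l)) c.l
      (g c.l ^ (d c.l : ℤ) * g c.r * g c.l ^ (-(d c.l : ℤ)))

/-- Generators of the knot group: one for each height (between two consecutive crossings) and
each of the four strands at that height. -/
abbrev Gen (ns : List ℤ) : Type := Fin ((word ns).length + 1) × Fin 4

/-- The directions of the strands at height `t`. -/
def dirAt (ns : List ℤ) (o : Fin 4 → ℤˣ) (t : ℕ) : Fin 4 → ℤˣ :=
  fun s => o (strandPerm ((word ns).take t) s)

/-- The Wirtinger relations of the oriented diagram: one set for each crossing, and those which
identify the generators of strands that are joined at the top or at the bottom. -/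
def wirtingerRels (ns : List ℤ) (o : Fin 4 → ℤˣ) : Set (FreeGroup (Gen ns)) :=
  {x | ∃ (t : Fin (word ns).length) (s : Fin 4),
      x = FreeGroup.of (t.succ, s) *
        (((word ns).get t).conj (dirAt ns o t) (fun s' => FreeGroup.of (t.castSucc, s')) s)⁻¹} ∪
  {x | ∃ s : Fin 4, x = FreeGroup.of (0, topCap s) * (FreeGroup.of (0, s))⁻¹} ∪
  {x | ∃ s : Fin 4, x = FreeGroup.of (Fin.last _, bottomCap ns.length s) *
        (FreeGroup.of (Fin.last _, s))⁻¹}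

/-- The knot group `G(K)`, by its Wirtinger presentation from the oriented diagram. -/
abbrev KnotGroup (ns : List ℤ) (o : Fin 4 → ℤˣ) : Type :=
  PresentedGroup (wirtingerRels ns o)

/-- The parabolic matrix `I + x x̂`, `x̂ = (-x₂, x₁)`, of a vector `x`. -/
def parabolic (x : Fin 2 → ℂ) : Matrix.SpecialLinearGroup (Fin 2) ℂ :=
  ⟨!![1 - x 0 * x 1, x 0 ^ 2; -x 1 ^ 2, 1 + x 0 * x 1], by
    rw [Matrix.det_fin_two_of]; ring⟩

/-- `ρ` is the representation given by the arc coloring with `⟨a, b⟩ = r`: it sends the Wirtinger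
generator of each arc to the parabolic matrix of the vector on that arc. -/
def IsColoringRep (ns : List ℤ) (o : Fin 4 → ℤˣ) (r : ℂ)
    (ρ : KnotGroup ns o →* Matrix.SpecialLinearGroup (Fin 2) ℂ) : Prop :=
  ∀ g : Gen ns, ρ (PresentedGroup.of g) =
    parabolic (colorAfter ((word ns).take g.1) o (topColor r) g.2)

/-- The trace field `ℚ(tr ρ(γ) | γ ∈ G)` of a representation. -/
def traceField {G : Type*} [Group G] (ρ : G →* Matrix.SpecialLinearGroup (Fin 2) ℂ) :
    IntermediateField ℚ ℂ :=
  IntermediateField.adjoin ℚ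
    (Set.range fun γ : G => Matrix.trace (ρ γ : Matrix (Fin 2) (Fin 2) ℂ))

end TwoBridge

end

noncomputable section

namespace TwoBridge

/-! ### Crossings, words and directions -/

/-! A vector acts by its transvection, so vectors matter only up to sign, and the product of the
four transvections, taken with directions, is the same at every height (`totalTwist_colorAfter`). It
is trivial at the top. At a root of the closing determinant one bottom pair is parallel, and
triviality of the product then forces the vectors in both bottom pairs to agree up to sign
(`signEq_bottomCap`).

The coloring can therefore be read upwards, starting from the bottom vectors. For odd `k` the
diagram is turned over and seen from behind, and the vectors change by `backColor`; for even `k` it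
is rotated in the plane, and positions 0 and 2 are exchanged. A linear map of determinant `±1` puts
the starting vectors in standard position, so this is the coloring of `K'` at `±u_k(r)` up to signs.
It ends in the top vectors of `K`: its closing determinant vanishes, and its own last determinant is
`±r` (`upsideDown_coloring`).

Thus `r` and `u_k(r)` are, up to sign, values of integer polynomials at each other, which gives the
equality of fields. The trace field at a root `r` is `ℚ(r²)` (`traceField_eq`), and squares of
determinants of arc vectors lie in it because `tr = 2 - ⟨x, y⟩²`. Applied to `K` and `K'`, this puts
`r²` and `u_k(r)²` in each other's fields. -/

lemma Crossing.l_ne_r (c : Crossing) : c.l ≠ c.r :=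
  (Fin.castSucc_lt_succ (i := c.left)).ne

@[simp] lemma Crossing.swap_l (c : Crossing) : c.swap c.l = c.r := Equiv.swap_apply_left _ _

@[simp] lemma Crossing.swap_r (c : Crossing) : c.swap c.r = c.l := Equiv.swap_apply_right _ _

@[simp] lemma Crossing.swap_inv (c : Crossing) : c.swap⁻¹ = c.swap := Equiv.swap_inv _ _

@[simp] lemma strandPerm_nil : strandPerm [] = 1 := rfl

@[simp] lemma strandPerm_cons (c : Crossing) (w : List Crossing) :
    strandPerm (c :: w) = c.swap * strandPerm w := by
  simp [strandPerm]

lemma strandPerm_append (w₁ w₂ : List Crossing) :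
    strandPerm (w₁ ++ w₂) = strandPerm w₁ * strandPerm w₂ := by
  simp [strandPerm]

/-- Reversing a word and conjugating all crossings by an involution `σ` of the positions inverts
and conjugates its strand permutation. -/
lemma strandPerm_map_reverse {σ : Equiv.Perm (Fin 4)} (hσ : σ * σ = 1) (φ : Crossing → Crossing)
    (w : List Crossing) (hφ : ∀ c ∈ w, (φ c).swap = σ * c.swap * σ) :
    strandPerm (w.map φ).reverse = σ * (strandPerm w)⁻¹ * σ := by
  induction w with
  | nil => simp [hσ]
  | cons c w ih =>
    have h := ih fun c' hc' => hφ c' (List.mem_cons_of_mem _ hc')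
    simp only [List.map_cons, List.reverse_cons, strandPerm_append, h, strandPerm_cons,
      strandPerm_nil, mul_one, hφ c List.mem_cons_self, mul_inv_rev, Crossing.swap_inv]
    calc σ * (strandPerm w)⁻¹ * σ * (σ * c.swap * σ)
        = σ * (strandPerm w)⁻¹ * (σ * σ) * c.swap * σ := by group
      _ = _ := by rw [hσ]; group

lemma wordFrom_append (i : ℕ) (l₁ l₂ : List ℤ) :
    wordFrom i (l₁ ++ l₂) = wordFrom i l₁ ++ wordFrom (i + l₁.length) l₂ := by
  induction l₁ generalizing i with
  | nil => simp [wordFrom]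
  | cons n l ih => simp [wordFrom, ih, add_assoc, add_comm 1]

lemma block_congr {i j : ℕ} (h : Even i ↔ Even j) (n : ℤ) : block i n = block j n := by
  have hp : (-1 : ℤ) ^ i = (-1) ^ j := by
    by_cases hi : Even i
    · rw [hi.neg_one_pow, (h.1 hi).neg_one_pow]
    · rw [(Nat.not_even_iff_odd.1 hi).neg_one_pow,
        (Nat.not_even_iff_odd.1 (mt h.2 hi)).neg_one_pow]
  simp only [block, blockPos, hp, h]

/-- A block depends only on its number and on the parity of its index. The block with index `i + m`
moves to index `j + l.length - 1 - m`, and the hypothesis says that these parities agree. -/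
lemma wordFrom_reverse (i j : ℕ) (l : List ℤ) (h : Even (i + j + l.length + 1)) :
    (wordFrom i l).reverse = wordFrom j l.reverse := by
  induction l generalizing i with
  | nil => simp [wordFrom]
  | cons n l ih =>
    rw [wordFrom, List.reverse_append, List.reverse_cons, wordFrom_append,
      ih (i + 1) (by simpa [add_assoc, add_comm, add_left_comm] using h)]
    have : (block i n).reverse = block (j + l.reverse.length) n := by
      rw [block, List.reverse_replicate]
      apply block_congr
      rw [List.length_reverse]
      rw [List.length_cons] at h
      grind
    rw [this, wordFrom, wordFrom, List.append_nil]

/-- The crossing obtained by exchanging the positions `0` and `2`. -/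
def Crossing.flip (c : Crossing) : Crossing := ⟨if c.left = 0 then 1 else 0, c.right⟩

/-- The sign of `n` and the parity shift cancel in `(-1) ^ i * n`, so handedness is kept and only
the position of the block changes. -/
lemma wordFrom_map_neg (i : ℕ) (l : List ℤ) :
    wordFrom i (l.map fun n => -n) = (wordFrom (i + 1) l).map Crossing.flip := by
  induction l generalizing i with
  | nil => rfl
  | cons n l ih =>
    rw [List.map_cons, wordFrom, wordFrom, List.map_append, ih]
    congr 1
    by_cases hi : Even i <;>
      simp [block, Crossing.flip, blockPos, pow_succ, Nat.even_add_one, hi]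

/-- The rightmost strand is never crossed; `Crossing.flip` exchanges positions correctly only for
such crossings. -/
lemma left_ne_two_of_mem_wordFrom (i : ℕ) (l : List ℤ) :
    ∀ c ∈ wordFrom i l, c.left ≠ 2 := by
  induction l generalizing i with
  | nil => simp [wordFrom]
  | cons n l ih =>
    intro c hc
    rw [wordFrom, List.mem_append] at hc
    rcases hc with hc | hc
    · rw [List.eq_of_mem_replicate hc]
      simp only [blockPos]
      split_ifs <;> decide
    · exact ih _ c hc

@[simp] lemma length_upsideDown (ns : List ℤ) : (upsideDown ns).length = ns.length := by
  simp [upsideDown]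

lemma word_upsideDown_of_odd {ns : List ℤ} (h : Odd ns.length) :
    word (upsideDown ns) = (word ns).reverse := by
  have h1 : Even (ns.length + 1) := h.add_one
  rw [word, word, upsideDown, wordFrom_reverse 0 0 ns (by simpa using h1)]
  simp [h1.neg_one_pow]

lemma word_upsideDown_of_even {ns : List ℤ} (h : Even ns.length) :
    word (upsideDown ns) = ((word ns).map Crossing.flip).reverse := by
  have h1 : Odd (ns.length + 1) := h.add_one
  have h2 : upsideDown ns = ns.reverse.map fun n => -n := by
    simp [upsideDown, h1.neg_one_pow]
  rw [word, word, h2, wordFrom_map_neg, ← List.map_reverse,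
    wordFrom_reverse 0 (0 + 1) ns (by grind)]

lemma upsideDown_ne_nil {ns : List ℤ} (h : ns ≠ []) : upsideDown ns ≠ [] := by
  simpa [upsideDown] using h

/-- A function on the strands of a knot diagram which is compatible with the arcs at the top and at
the bottom is constant. -/
lemma apply_eq_of_isKnot {ns : List ℤ} (hK : IsKnot ns) {f : Fin 4 → ℤˣ}
    (h₁ : ∀ s, f (topCap s) = f s)
    (h₂ : ∀ s, f (strandPerm (word ns) (bottomCap ns.length s)) = f (strandPerm (word ns) s)) :
    ∀ s t, f s = f t := by
  intro s t
  obtain ⟨⟨g, hg⟩, rfl⟩ := hK.exists_smul_eq t s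
  change f (g t) = f t
  induction hg using Subgroup.closure_induction generalizing t with
  | mem x hx =>
    rcases hx with rfl | rfl
    · exact h₁ t
    · simpa using h₂ ((strandPerm (word ns))⁻¹ t)
  | one => rfl
  | mul x y _ _ hx hy => rw [Equiv.Perm.mul_apply, hx, hy]
  | inv x _ hx => simpa using (hx (x⁻¹ t)).symm

/-! ### Colorings up to signs -/

section Ring

variable {R : Type*} [CommRing R]

/-- The power `e = ±1` of the symplectic transvection `y ↦ y + ⟨x, y⟩ x`. -/
def twist (e : ℤˣ) (x y : Fin 2 → R) : Fin 2 → R := y + (((e : ℤ) : R) * form x y) • x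

/-- Two colorings agree up to a sign for each strand. -/
def SignEq (v w : Fin 4 → Fin 2 → R) : Prop := ∀ s, v s = w s ∨ v s = -w s

lemma SignEq.refl (v : Fin 4 → Fin 2 → R) : SignEq v v := fun _ => Or.inl rfl

lemma SignEq.trans {u v w : Fin 4 → Fin 2 → R} (h₁ : SignEq u v) (h₂ : SignEq v w) :
    SignEq u w := by
  intro s
  rcases h₁ s with h | h <;> rcases h₂ s with h' | h' <;> simp [h, h']

@[simp] lemma form_neg_left (x y : Fin 2 → R) : form (-x) y = -form x y := by
  simp only [form, Pi.neg_apply]; ring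

@[simp] lemma form_neg_right (x y : Fin 2 → R) : form x (-y) = -form x y := by
  simp only [form, Pi.neg_apply]; ring

@[simp] lemma form_self (x : Fin 2 → R) : form x x = 0 := by
  simp only [form]; ring

lemma form_swap (x y : Fin 2 → R) : form x y = -form y x := by
  simp only [form]; ring

@[simp] lemma twist_neg_left (e : ℤˣ) (x y : Fin 2 → R) : twist e (-x) y = twist e x y := by
  simp [twist]

@[simp] lemma twist_neg_right (e : ℤˣ) (x y : Fin 2 → R) : twist e x (-y) = -twist e x y := by
  simp [twist]; abel

@[simp] lemma twist_self (e : ℤˣ) (x : Fin 2 → R) : twist e x x = x := by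
  simp [twist]

@[simp] lemma form_twist_right (e : ℤˣ) (x y : Fin 2 → R) :
    form x (twist e x y) = form x y := by
  simp only [form, twist, Pi.add_apply, Pi.smul_apply, smul_eq_mul]; ring

@[simp] lemma form_twist_left (e : ℤˣ) (x y : Fin 2 → R) :
    form (twist e x y) x = form y x := by
  rw [form_swap, form_twist_right, ← form_swap]

lemma form_twist_twist (e : ℤˣ) (x y z : Fin 2 → R) :
    form (twist e x y) (twist e x z) = form y z := by
  simp only [form, twist, Pi.add_apply, Pi.smul_apply, smul_eq_mul]; ring

@[simp] lemma twist_neg_twist (e : ℤˣ) (x y : Fin 2 → R) : twist (-e) x (twist e x y) = y := by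
  ext i
  simp only [twist, form, Pi.add_apply, Pi.smul_apply, smul_eq_mul, Units.val_neg, Int.cast_neg]
  ring

@[simp] lemma twist_twist_neg (e : ℤˣ) (x y : Fin 2 → R) : twist e x (twist (-e) x y) = y := by
  simpa using twist_neg_twist (-e) x y

/-- Transvections preserve the form, so conjugating one by another gives the transvection along the
image vector. This is the relation behind every crossing computation below. -/
lemma twist_conj (d e : ℤˣ) (u v x : Fin 2 → R) :
    twist d (twist e u v) (twist e u x) = twist e u (twist d v x) := by
  ext i
  rw [twist, form_twist_twist]
  simp only [twist, form, Pi.add_apply, Pi.smul_apply, smul_eq_mul]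
  ring

lemma SignEq.form {v w : Fin 4 → Fin 2 → R} (h : SignEq v w) (s t : Fin 4) :
    form (v s) (v t) = form (w s) (w t) ∨ form (v s) (v t) = -form (w s) (w t) := by
  rcases h s with h₁ | h₁ <;> rcases h t with h₂ | h₂ <;> simp [h₁, h₂]

lemma Crossing.color_right_l {c : Crossing} (h : c.right = true) (d : Fin 4 → ℤˣ)
    (v : Fin 4 → Fin 2 → R) : c.color d v c.l = v c.r := by
  simp [Crossing.color, h, c.l_ne_r]

lemma Crossing.color_right_r {c : Crossing} (h : c.right = true) (d : Fin 4 → ℤˣ)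
    (v : Fin 4 → Fin 2 → R) : c.color d v c.r = -twist (-d c.r) (v c.r) (v c.l) := by
  ext i
  simp only [Crossing.color, h, if_true, Function.update_self, twist, form, Pi.sub_apply,
    Pi.neg_apply, Pi.smul_apply, Pi.add_apply, smul_eq_mul, Units.val_neg, Int.cast_neg]
  ring

lemma Crossing.color_left_r {c : Crossing} (h : c.right = false) (d : Fin 4 → ℤˣ)
    (v : Fin 4 → Fin 2 → R) : c.color d v c.r = v c.l := by
  simp [Crossing.color, h, c.l_ne_r.symm]

lemma Crossing.color_left_l {c : Crossing} (h : c.right = false) (d : Fin 4 → ℤˣ)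
    (v : Fin 4 → Fin 2 → R) : c.color d v c.l = -twist (d c.l) (v c.l) (v c.r) := by
  ext i
  simp [Crossing.color, h, twist]
  ring

lemma Crossing.color_of_ne (c : Crossing) (d : Fin 4 → ℤˣ) (v : Fin 4 → Fin 2 → R) {s : Fin 4}
    (hl : s ≠ c.l) (hr : s ≠ c.r) : c.color d v s = v s := by
  unfold Crossing.color; split_ifs <;> simp [hl, hr]

lemma SignEq.color {v w : Fin 4 → Fin 2 → R} (h : SignEq v w) (c : Crossing) (d : Fin 4 → ℤˣ) :
    SignEq (c.color d v) (c.color d w) := by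
  intro s
  by_cases hl : s = c.l
  · subst hl
    cases hc : c.right
    · rw [Crossing.color_left_l hc, Crossing.color_left_l hc]
      rcases h c.l with h₁ | h₁ <;> rcases h c.r with h₂ | h₂ <;> simp [h₁, h₂]
    · rw [Crossing.color_right_l hc, Crossing.color_right_l hc]
      exact h _
  by_cases hr : s = c.r
  · subst hr
    cases hc : c.right
    · rw [Crossing.color_left_r hc, Crossing.color_left_r hc]
      exact h _
    · rw [Crossing.color_right_r hc, Crossing.color_right_r hc]
      rcases h c.l with h₁ | h₁ <;> rcases h c.r with h₂ | h₂ <;> simp [h₁, h₂]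
  · rw [c.color_of_ne d v hl hr, c.color_of_ne d w hl hr]
    exact h s

lemma SignEq.colorAfter {v w : Fin 4 → Fin 2 → R} (h : SignEq v w) (l : List Crossing)
    (d : Fin 4 → ℤˣ) : SignEq (colorAfter l d v) (colorAfter l d w) := by
  induction l generalizing d v w with
  | nil => exact h
  | cons c l ih => exact ih (h.color c d) _

lemma colorAfter_append (w₁ w₂ : List Crossing) (d : Fin 4 → ℤˣ) (v : Fin 4 → Fin 2 → R) :
    colorAfter (w₁ ++ w₂) d v =
      colorAfter w₂ (fun s => d (strandPerm w₁ s)) (colorAfter w₁ d v) := by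
  induction w₁ generalizing d v with
  | nil => rfl
  | cons c w ih => simp [colorAfter, ih]

lemma Crossing.form_color (c : Crossing) (d : Fin 4 → ℤˣ) (v : Fin 4 → Fin 2 → R) :
    form (c.color d v c.l) (c.color d v c.r) = form (v c.l) (v c.r) := by
  cases hc : c.right
  · rw [c.color_left_l hc, c.color_left_r hc, form_neg_left, form_twist_left, ← form_swap]
  · rw [c.color_right_l hc, c.color_right_r hc, form_neg_right, form_twist_right, ← form_swap]

lemma form_colorAfter_replicate (c : Crossing) (n : ℕ) (d : Fin 4 → ℤˣ)
    (v : Fin 4 → Fin 2 → R) :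
    form (colorAfter (List.replicate n c) d v c.l) (colorAfter (List.replicate n c) d v c.r) =
      form (v c.l) (v c.r) := by
  induction n generalizing d v with
  | zero => rfl
  | succ n ih => rw [List.replicate_succ, colorAfter, ih, c.form_color]

/-- A map which multiplies the symplectic form by a sign intertwines the colorings of two
orientations differing by that sign. -/
lemma Crossing.color_map (c : Crossing) (e : ℤˣ) (g : (Fin 2 → R) →ₗ[R] (Fin 2 → R))
    (hg : ∀ x y, form (g x) (g y) = ((e : ℤ) : R) * form x y) (d : Fin 4 → ℤˣ)
    (v : Fin 4 → Fin 2 → R) :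
    c.color (fun s => e * d s) (fun s => g (v s)) = fun s => g (c.color d v s) := by
  have ht (a : ℤˣ) (x y : Fin 2 → R) : twist (e * a) (g x) (g y) = g (twist a x y) := by
    -- One sign comes from the direction and one from the form; they cancel because `e² = 1`.
    have he : ((e : ℤ) : R) * ((e : ℤ) : R) = 1 := by
      rw [← Int.cast_mul, ← Units.val_mul, Int.units_mul_self]; simp
    rw [twist, twist, hg, map_add, map_smul]
    congr 2
    push_cast
    linear_combination (((a : ℤ) : R) * form x y) * he
  funext s
  by_cases hl : s = c.l
  · subst hl
    cases hc : c.right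
    · rw [Crossing.color_left_l hc, Crossing.color_left_l hc, ht, map_neg]
    · rw [Crossing.color_right_l hc, Crossing.color_right_l hc]
  by_cases hr : s = c.r
  · subst hr
    cases hc : c.right
    · rw [Crossing.color_left_r hc, Crossing.color_left_r hc]
    · rw [Crossing.color_right_r hc, Crossing.color_right_r hc, ← mul_neg, ht, map_neg]
  · rw [c.color_of_ne _ _ hl hr, c.color_of_ne _ _ hl hr]

lemma colorAfter_map (w : List Crossing) (e : ℤˣ) (g : (Fin 2 → R) →ₗ[R] (Fin 2 → R))
    (hg : ∀ x y, form (g x) (g y) = ((e : ℤ) : R) * form x y) (d : Fin 4 → ℤˣ)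
    (v : Fin 4 → Fin 2 → R) :
    colorAfter w (fun s => e * d s) (fun s => g (v s)) = fun s => g (colorAfter w d v s) := by
  induction w generalizing d v with
  | nil => rfl
  | cons c w ih => rw [colorAfter, colorAfter, c.color_map e g hg, ih]

/-! ### Reading a word upwards -/

/-- An abstract induction serving both parities of `k`: if the transformation `T` lets the image of
each single crossing be undone from below, with directions negated, then a whole word is undone. -/
lemma colorAfter_map_reverse {σ : Equiv.Perm (Fin 4)} (hσ : σ * σ = 1) (φ : Crossing → Crossing)
    (T : (Fin 4 → ℤˣ) → (Fin 4 → Fin 2 → R) → Fin 4 → Fin 2 → R) (w : List Crossing)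
    (hφ : ∀ c ∈ w, (φ c).swap = σ * c.swap * σ)
    (hT : ∀ c ∈ w, ∀ d v, SignEq ((φ c).color (fun s => -d (c.swap (σ s)))
      (T (fun s => d (c.swap s)) (c.color d v))) (T d v))
    (d : Fin 4 → ℤˣ) (v : Fin 4 → Fin 2 → R) :
    SignEq (colorAfter (w.map φ).reverse (fun s => -d (strandPerm w (σ s)))
      (T (fun s => d (strandPerm w s)) (colorAfter w d v))) (T d v) := by
  induction w generalizing d v with
  | nil => exact SignEq.refl _
  | cons c w ih =>
    have hφ' : ∀ c ∈ w, (φ c).swap = σ * c.swap * σ :=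
      fun c' h => hφ c' (List.mem_cons_of_mem _ h)
    have h := ih hφ' (fun c' h => hT c' (List.mem_cons_of_mem _ h)) (fun s => d (c.swap s))
      (c.color d v)
    refine SignEq.trans ?_ (hT c List.mem_cons_self d v)
    have hd : (fun s => -d (strandPerm (c :: w) (σ (strandPerm (w.map φ).reverse s)))) =
        fun s => -d (c.swap (σ s)) := by
      funext s
      have : ∀ s, σ (σ s) = s := fun s => by rw [← Equiv.Perm.mul_apply, hσ]; rfl
      simp [strandPerm_map_reverse hσ φ w hφ', this]
    rw [List.map_cons, List.reverse_cons, colorAfter_append, hd]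
    exact SignEq.color h (φ c) (fun s => -d (c.swap (σ s)))

/-- The colors seen from behind the diagram: each one is transformed by the twists along
all strands to the left. -/
def backColor (d : Fin 4 → ℤˣ) (v : Fin 4 → Fin 2 → R) : Fin 4 → Fin 2 → R :=
  ![v 0, twist (d 0) (v 0) (v 1), twist (d 0) (v 0) (twist (d 1) (v 1) (v 2)),
    twist (d 0) (v 0) (twist (d 1) (v 1) (twist (d 2) (v 2) (v 3)))]

/-- The product of the twists along all strands. -/
def totalTwist (d : Fin 4 → ℤˣ) (v : Fin 4 → Fin 2 → R) (x : Fin 2 → R) : Fin 2 → R :=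
  twist (d 0) (v 0) (twist (d 1) (v 1) (twist (d 2) (v 2) (twist (d 3) (v 3) x)))

lemma twist_twist_conj_neg (d e : ℤˣ) (a b x : Fin 2 → R) :
    twist e b (twist d (twist (-e) b a) x) = twist d a (twist e b x) := by
  rw [← twist_conj, twist_twist_neg]

lemma Crossing.color_zero_true (d : Fin 4 → ℤˣ) (v : Fin 4 → Fin 2 → R) :
    Crossing.color ⟨0, true⟩ d v = ![v 1, -twist (-d 1) (v 1) (v 0), v 2, v 3] := by
  funext s
  fin_cases s
  · exact Crossing.color_right_l (c := ⟨0, true⟩) rfl d v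
  · exact Crossing.color_right_r (c := ⟨0, true⟩) rfl d v
  · exact Crossing.color_of_ne ⟨0, true⟩ d v (by decide) (by decide)
  · exact Crossing.color_of_ne ⟨0, true⟩ d v (by decide) (by decide)

lemma Crossing.color_zero_false (d : Fin 4 → ℤˣ) (v : Fin 4 → Fin 2 → R) :
    Crossing.color ⟨0, false⟩ d v = ![-twist (d 0) (v 0) (v 1), v 0, v 2, v 3] := by
  funext s
  fin_cases s
  · exact Crossing.color_left_l (c := ⟨0, false⟩) rfl d v
  · exact Crossing.color_left_r (c := ⟨0, false⟩) rfl d v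
  · exact Crossing.color_of_ne ⟨0, false⟩ d v (by decide) (by decide)
  · exact Crossing.color_of_ne ⟨0, false⟩ d v (by decide) (by decide)

lemma Crossing.color_one_true (d : Fin 4 → ℤˣ) (v : Fin 4 → Fin 2 → R) :
    Crossing.color ⟨1, true⟩ d v = ![v 0, v 2, -twist (-d 2) (v 2) (v 1), v 3] := by
  funext s
  fin_cases s
  · exact Crossing.color_of_ne ⟨1, true⟩ d v (by decide) (by decide)
  · exact Crossing.color_right_l (c := ⟨1, true⟩) rfl d v
  · exact Crossing.color_right_r (c := ⟨1, true⟩) rfl d v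
  · exact Crossing.color_of_ne ⟨1, true⟩ d v (by decide) (by decide)

lemma Crossing.color_one_false (d : Fin 4 → ℤˣ) (v : Fin 4 → Fin 2 → R) :
    Crossing.color ⟨1, false⟩ d v = ![v 0, -twist (d 1) (v 1) (v 2), v 1, v 3] := by
  funext s
  fin_cases s
  · exact Crossing.color_of_ne ⟨1, false⟩ d v (by decide) (by decide)
  · exact Crossing.color_left_l (c := ⟨1, false⟩) rfl d v
  · exact Crossing.color_left_r (c := ⟨1, false⟩) rfl d v
  · exact Crossing.color_of_ne ⟨1, false⟩ d v (by decide) (by decide)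

lemma Crossing.coe_swap_zero (h : Bool) : ⇑(Crossing.swap ⟨0, h⟩) = ![1, 0, 2, 3] := by
  funext s
  fin_cases s <;> rfl

lemma Crossing.coe_swap_one (h : Bool) : ⇑(Crossing.swap ⟨1, h⟩) = ![0, 2, 1, 3] := by
  funext s
  fin_cases s <;> rfl

lemma Crossing.eq_of_left_ne_two {p : Crossing → Prop} (h00 : p ⟨0, false⟩) (h01 : p ⟨0, true⟩)
    (h10 : p ⟨1, false⟩) (h11 : p ⟨1, true⟩) (c : Crossing) (hc : c.left ≠ 2) : p c := by
  obtain ⟨i, h⟩ := c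
  fin_cases i <;> cases h <;> first | assumption | exact absurd rfl hc

/-- The product corresponds to a loop around all four strands, which does not see the crossing: only
two adjacent factors change, and their product is kept by `twist_conj`. -/
lemma Crossing.totalTwist_color (c : Crossing) (hc : c.left ≠ 2) (d : Fin 4 → ℤˣ)
    (v : Fin 4 → Fin 2 → R) :
    totalTwist (fun s => d (c.swap s)) (c.color d v) = totalTwist d v := by
  funext x
  revert c
  refine Crossing.eq_of_left_ne_two ?_ ?_ ?_ ?_
  · simp [color_zero_false, coe_swap_zero, totalTwist, twist_conj]
  · simp [color_zero_true, coe_swap_zero, totalTwist, twist_twist_conj_neg]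
  · simp [color_one_false, coe_swap_one, totalTwist, twist_conj]
  · simp [color_one_true, coe_swap_one, totalTwist, twist_twist_conj_neg]

/-- Turning the diagram about a horizontal axis keeps left positions and handedness but exchanges
over and under; conjugation by the strands to the left accounts for the new viewpoint. -/
lemma Crossing.backColor_color (c : Crossing) (hc : c.left ≠ 2) (d : Fin 4 → ℤˣ)
    (v : Fin 4 → Fin 2 → R) :
    SignEq (c.color (fun s => -d (c.swap s)) (backColor (fun s => d (c.swap s)) (c.color d v)))
      (backColor d v) := by
  revert c
  refine Crossing.eq_of_left_ne_two ?_ ?_ ?_ ?_ <;> intro s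
  · rw [color_zero_false, color_zero_false]
    fin_cases s <;> simp [backColor, coe_swap_zero, twist_conj]
  · rw [color_zero_true, color_zero_true]
    fin_cases s <;> simp [backColor, coe_swap_zero, twist_twist_conj_neg]
  · rw [color_one_false, color_one_false]
    fin_cases s <;> simp [backColor, coe_swap_one, twist_conj]
  · rw [color_one_true, color_one_true]
    fin_cases s <;> simp [backColor, coe_swap_one, twist_conj, twist_twist_conj_neg]

/-- A rotation in the plane keeps the over-strand over, so here the vectors are merely permuted. -/
lemma Crossing.flipColor_color (c : Crossing) (hc : c.left ≠ 2) (d : Fin 4 → ℤˣ)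
    (v : Fin 4 → Fin 2 → R) :
    SignEq (c.flip.color (fun s => -d (c.swap (Equiv.swap 0 2 s)))
      (fun s => c.color d v (Equiv.swap 0 2 s))) (fun s => v (Equiv.swap 0 2 s)) := by
  have hσ (f : Fin 4 → Fin 2 → R) :
      (fun s => f (Equiv.swap 0 2 s)) = ![f 2, f 1, f 0, f 3] := by
    funext s
    fin_cases s <;> rfl
  have hσ1 : Equiv.swap (0 : Fin 4) 2 1 = 1 := by decide
  rw [hσ, hσ]
  revert c
  refine Crossing.eq_of_left_ne_two ?_ ?_ ?_ ?_ <;> intro s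
  · rw [color_zero_false, show Crossing.flip ⟨0, false⟩ = ⟨1, false⟩ from rfl, color_one_false]
    fin_cases s <;> simp [coe_swap_zero, hσ1]
  · rw [color_zero_true, show Crossing.flip ⟨0, true⟩ = ⟨1, true⟩ from rfl, color_one_true]
    fin_cases s <;> simp [coe_swap_zero]
  · rw [color_one_false, show Crossing.flip ⟨1, false⟩ = ⟨0, false⟩ from rfl, color_zero_false]
    fin_cases s <;> simp [coe_swap_one]
  · rw [color_one_true, show Crossing.flip ⟨1, true⟩ = ⟨0, true⟩ from rfl, color_zero_true]
    fin_cases s <;> simp [coe_swap_one, hσ1]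

lemma Crossing.flip_swap (c : Crossing) (hc : c.left ≠ 2) :
    c.flip.swap = Equiv.swap 0 2 * c.swap * Equiv.swap 0 2 := by
  revert c
  refine Crossing.eq_of_left_ne_two ?_ ?_ ?_ ?_ <;> decide

end Ring

/-! ### Closing up at the bottom -/

section Field

variable {F : Type*} [Field F]

lemma twist_eq_self {e : ℤˣ} {x y : Fin 2 → F} (h : form x y = 0) : twist e x y = y := by
  simp [twist, h]

lemma twist_ne_zero (e : ℤˣ) (x : Fin 2 → F) {y : Fin 2 → F} (h : y ≠ 0) :
    twist e x y ≠ 0 := by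
  intro h0
  apply h
  rw [← twist_neg_twist e x y, h0]
  simp [twist, form]

lemma Crossing.color_ne_zero (c : Crossing) (d : Fin 4 → ℤˣ) {v : Fin 4 → Fin 2 → F}
    (h : ∀ s, v s ≠ 0) (s : Fin 4) : c.color d v s ≠ 0 := by
  by_cases hl : s = c.l
  · subst hl
    cases hc : c.right
    · rw [Crossing.color_left_l hc]
      exact neg_ne_zero.2 (twist_ne_zero _ _ (h _))
    · rw [Crossing.color_right_l hc]
      exact h _
  by_cases hr : s = c.r
  · subst hr
    cases hc : c.right
    · rw [Crossing.color_left_r hc]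
      exact h _
    · rw [Crossing.color_right_r hc]
      exact neg_ne_zero.2 (twist_ne_zero _ _ (h _))
  · rw [c.color_of_ne d v hl hr]
    exact h s

lemma colorAfter_ne_zero (w : List Crossing) (d : Fin 4 → ℤˣ) {v : Fin 4 → Fin 2 → F}
    (h : ∀ s, v s ≠ 0) : ∀ s, colorAfter w d v s ≠ 0 := by
  induction w generalizing d v with
  | nil => exact h
  | cons c w ih => exact ih _ (c.color_ne_zero d h)

/-- A transvection along a parallel vector does nothing, so the crossing only permutes the vectors,
up to sign. -/
lemma Crossing.signEq_color_swap (c : Crossing) (d : Fin 4 → ℤˣ) {v : Fin 4 → Fin 2 → F}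
    (h : form (v c.l) (v c.r) = 0) : SignEq v (fun s => c.color d v (c.swap s)) := by
  have h' : form (v c.r) (v c.l) = 0 := by rw [form_swap, h, neg_zero]
  intro s
  by_cases hl : s = c.l
  · subst hl
    dsimp only
    rw [Crossing.swap_l]
    cases hc : c.right
    · rw [Crossing.color_left_r hc]
      exact Or.inl rfl
    · rw [Crossing.color_right_r hc, twist_eq_self h', neg_neg]
      exact Or.inr rfl
  by_cases hr : s = c.r
  · subst hr
    dsimp only
    rw [Crossing.swap_r]
    cases hc : c.right
    · rw [Crossing.color_left_l hc, twist_eq_self h, neg_neg]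
      exact Or.inr rfl
    · rw [Crossing.color_right_l hc]
      exact Or.inl rfl
  · dsimp only
    rw [show c.swap s = s from Equiv.swap_apply_of_ne_of_ne hl hr, c.color_of_ne d v hl hr]
    exact Or.inl rfl

lemma form_eq_zero_of_colorAfter (w : List Crossing) (d : Fin 4 → ℤˣ) {v : Fin 4 → Fin 2 → F}
    (h : ∀ s t, form (colorAfter w d v s) (colorAfter w d v t) = 0) :
    ∀ s t, form (v s) (v t) = 0 := by
  induction w generalizing d v with
  | nil => exact h
  | cons c w ih =>
    have h1 := ih _ h
    intro s t
    have h2 := c.signEq_color_swap d ((c.form_color d v).symm.trans (h1 _ _))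
    rcases h2.form s t with h3 | h3 <;> simp [h3, h1]

lemma totalTwist_colorAfter (w : List Crossing) (hw : ∀ c ∈ w, c.left ≠ 2) (d : Fin 4 → ℤˣ)
    (v : Fin 4 → Fin 2 → F) :
    totalTwist (fun s => d (strandPerm w s)) (colorAfter w d v) = totalTwist d v := by
  induction w generalizing d v with
  | nil => rfl
  | cons c w ih =>
    rw [← c.totalTwist_color (hw c List.mem_cons_self) d v]
    have := ih (fun c' h => hw c' (List.mem_cons_of_mem _ h)) (fun s => d (c.swap s))
      (c.color d v)
    simpa only [strandPerm_cons, Equiv.Perm.mul_apply, colorAfter] using this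

lemma exists_eq_smul_of_form_eq_zero {x y : Fin 2 → F} (hx : x ≠ 0) (h : form x y = 0) :
    ∃ c : F, y = c • x := by
  simp only [form] at h
  by_cases h0 : x 0 = 0
  · have h1 : x 1 ≠ 0 := fun h1 => hx (by ext i; fin_cases i <;> simp [h0, h1])
    refine ⟨y 1 / x 1, ?_⟩
    have hy : y 0 = 0 := by simpa [h0, h1] using h
    ext i
    fin_cases i
    · simp [h0, hy]
    · simp [h1]
  · refine ⟨y 0 / x 0, ?_⟩
    ext i
    fin_cases i
    · simp [h0]
    · simp only [Fin.mk_one, Pi.smul_apply, smul_eq_mul]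
      field_simp
      linear_combination h

lemma form_smul_smul (a b : F) (x : Fin 2 → F) : form (a • x) (b • x) = 0 := by
  simp only [form, Pi.smul_apply, smul_eq_mul]; ring

/-- If the product of the four twists is trivial, the directions are opposite in pairs and one of
the two pairs is parallel, then the vectors in each pair agree up to sign. -/
lemma signEq_of_totalTwist {d : Fin 4 → ℤˣ} {p : Fin 4 → Fin 2 → F}
    (h : ∀ x, totalTwist d p x = x) (h01 : d 1 = -d 0) (h23 : d 3 = -d 2)
    (hf : form (p 2) (p 3) = 0) (h0 : ∀ s, p s ≠ 0) (hn : ¬ ∀ s t, form (p s) (p t) = 0) :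
    (p 1 = p 0 ∨ p 1 = -p 0) ∧ (p 3 = p 2 ∨ p 3 = -p 2) := by
  have hd (s) : ((d s : ℤ) : F) ≠ 0 := by rcases Int.units_eq_one_or (d s) with h | h <;> simp [h]
  -- The trivial product, split into one pair of factors on each side.
  have key (x) : twist (d 2) (p 2) (twist (-d 2) (p 3) x) =
      twist (d 0) (p 1) (twist (-d 0) (p 0) x) := by
    have := h x
    rw [totalTwist, h01, h23] at this
    conv_rhs => rw [← this]
    simp
  have h01' : form (p 0) (p 1) = 0 := by
    -- The two diagonal entries of `key`; their sum compares traces, which differ from 2 by the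
    -- squares of `⟨p 2, p 3⟩` and `⟨p 0, p 1⟩`.
    have e0 := congrFun (key ![1, 0]) 0
    have e1 := congrFun (key ![0, 1]) 1
    simp only [twist, form, Pi.add_apply, Pi.smul_apply, smul_eq_mul, Units.val_neg, Int.cast_neg,
      Matrix.cons_val_zero, Matrix.cons_val_one] at e0 e1
    have hd2 : ((d 0 : ℤ) : F) * ((d 0 : ℤ) : F) = 1 := by
      rw [← Int.cast_mul, ← Units.val_mul, Int.units_mul_self]; simp
    have : form (p 0) (p 1) ^ 2 = 0 := by
      simp only [form] at hf ⊢
      linear_combination -e0 - e1 +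
        ((d 2 : ℤ) : F) ^ 2 * (p 2 0 * p 3 1 - p 2 1 * p 3 0) * hf -
        (p 0 0 * p 1 1 - p 0 1 * p 1 0) ^ 2 * hd2
    exact pow_eq_zero_iff two_ne_zero |>.1 this
  obtain ⟨c, hc⟩ := exists_eq_smul_of_form_eq_zero (h0 2) hf
  obtain ⟨k, hk⟩ := exists_eq_smul_of_form_eq_zero (h0 0) h01'
  -- With both pairs parallel, each side of `key` is the identity plus a map into the line of `p 2`,
  -- respectively `p 0`. These lines are distinct, so both maps vanish, giving `c² = k² = 1`.
  have key' (x) : (((d 2 : ℤ) : F) * (1 - c ^ 2) * form (p 2) x) • p 2 =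
      (((d 0 : ℤ) : F) * (k ^ 2 - 1) * form (p 0) x) • p 0 := by
    have := key x
    rw [hc, hk] at this
    ext i
    have := congrFun this i
    simp only [twist, form, Pi.add_apply, Pi.smul_apply, smul_eq_mul, Units.val_neg,
      Int.cast_neg] at this ⊢
    linear_combination this
  have hne : form (p 0) (p 2) ≠ 0 := by
    intro hz
    obtain ⟨m, hm⟩ := exists_eq_smul_of_form_eq_zero (h0 0) hz
    have hall (s) : ∃ a : F, p s = a • p 0 := by
      fin_cases s
      · exact ⟨1, by simp⟩
      · exact ⟨k, hk⟩
      · exact ⟨m, hm⟩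
      · exact ⟨c * m, by simp only [mul_smul]; rw [← hm]; exact hc⟩
    apply hn
    intro s t
    obtain ⟨a, ha⟩ := hall s
    obtain ⟨b, hb⟩ := hall t
    rw [ha, hb, form_smul_smul]
  have hne' : form (p 2) (p 0) ≠ 0 := by
    rw [form_swap]; exact neg_ne_zero.2 hne
  have hc1 : c ^ 2 = 1 := by
    have := key' (p 0)
    simp [hd, hne', h0, sub_eq_zero] at this
    exact this.symm
  have hk1 : k ^ 2 = 1 := by
    have := (key' (p 2)).symm
    simpa [hd, hne, h0, sub_eq_zero] using this
  constructor
  · rcases sq_eq_sq_iff_eq_or_eq_neg.1 (hk1.trans (one_pow 2).symm) with h | h <;> simp [hk, h]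
  · rcases sq_eq_sq_iff_eq_or_eq_neg.1 (hc1.trans (one_pow 2).symm) with h | h <;> simp [hc, h]

lemma topColor_topCap {R : Type*} [CommRing R] (u : R) (s : Fin 4) :
    topColor u (topCap s) = topColor u s := by
  fin_cases s <;> rfl

lemma topColor_ne_zero {u : F} (hu : u ≠ 0) (s : Fin 4) : topColor u s ≠ 0 := by
  intro h
  fin_cases s
  · simpa [topColor] using congrFun h 0
  · simpa [topColor] using congrFun h 0
  · exact hu (by simpa [topColor] using congrFun h 1)
  · exact hu (by simpa [topColor] using congrFun h 1)

lemma not_form_eq_zero {ns : List ℤ} (o : Fin 4 → ℤˣ) {r : F} (hr : r ≠ 0) :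
    ¬ ∀ s t, form (colorAfter (word ns) o (topColor r) s)
      (colorAfter (word ns) o (topColor r) t) = 0 := by
  intro h
  apply hr
  simpa [form, topColor] using form_eq_zero_of_colorAfter _ _ h 0 2

/-- The determinant at the bottom, evaluated at a number. -/
def closingForm (ns : List ℤ) (o : Fin 4 → ℤˣ) (r : F) : F :=
  let v := colorAfter (word ns) o (topColor r)
  if Odd ns.length then form (v 2) (v 3) else form (v 0) (v 3)

/-- At a root of the closing determinant, the arc vectors at the bottom match up to sign. -/
theorem signEq_bottomCap {ns : List ℤ} {o : Fin 4 → ℤˣ} (ho : IsOrientation ns o) {r : F}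
    (hr : r ≠ 0) (h : closingForm ns o r = 0) :
    SignEq (fun s => colorAfter (word ns) o (topColor r) (bottomCap ns.length s))
      (colorAfter (word ns) o (topColor r)) := by
  set v := colorAfter (word ns) o (topColor r) with hv
  set d : Fin 4 → ℤˣ := fun s => o (strandPerm (word ns) s) with hd
  have hdb (s) : d (bottomCap ns.length s) = -d s := ho.2 s
  have ht (x) : totalTwist d v x = x := by
    rw [hd, hv, totalTwist_colorAfter (word ns) (left_ne_two_of_mem_wordFrom 0 ns)]
    have h1 : o 1 = -o 0 := ho.1 0
    have h3 : o 3 = -o 2 := ho.1 2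
    have e1 : topColor r 1 = topColor r 0 := rfl
    have e3 : topColor r 3 = topColor r 2 := rfl
    simp [totalTwist, h1, h3, e1, e3]
  have h0 : ∀ s, v s ≠ 0 := colorAfter_ne_zero _ _ (topColor_ne_zero hr)
  have hn : ¬ ∀ s t, form (v s) (v t) = 0 := not_form_eq_zero o hr
  have neg_iff {x y : Fin 2 → F} : (x = y ∨ x = -y) → (y = x ∨ y = -x) := by
    rintro (h | h) <;> simp [h]
  by_cases hk : Odd ns.length
  · have hb : bottomCap ns.length = Equiv.swap 0 1 * Equiv.swap 2 3 := by simp [bottomCap, hk]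
    rw [closingForm, if_pos hk] at h
    rw [hb] at hdb ⊢
    obtain ⟨h1, h2⟩ := signEq_of_totalTwist ht (hdb 0) (hdb 2) h h0 hn
    intro s
    fin_cases s
    · exact h1
    · exact neg_iff h1
    · exact h2
    · exact neg_iff h2
  · have hb : bottomCap ns.length = Equiv.swap 0 3 * Equiv.swap 1 2 := by simp [bottomCap, hk]
    rw [closingForm, if_neg hk] at h
    rw [hb] at hdb ⊢
    -- For even `k` the caps join 1 with 2 and 3 with 0. Conjugating by the first factor rotates the
    -- product cyclically, so that these pairs become adjacent.
    have ht' (x) : totalTwist (fun s => d (s + 1)) (fun s => v (s + 1)) x = x := by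
      have := congrArg (twist (-d 0) (v 0)) (ht (twist (d 0) (v 0) x))
      simpa [totalTwist] using this
    obtain ⟨h1, h2⟩ := signEq_of_totalTwist ht' (hdb 1) (hdb 3)
      (by rw [form_swap]; simpa using h) (fun s => h0 _) (fun h => hn fun s t => by
        simpa using h (s - 1) (t - 1))
    intro s
    fin_cases s
    · exact neg_iff h2
    · exact h1
    · exact neg_iff h1
    · exact h2

end Field

/-! ### The upside-down diagram -/

section UpsideDown

variable {F : Type*} [Field F]

/-- The determinant of the two arc vectors below the last block. -/
def lastForm (ns : List ℤ) (o : Fin 4 → ℤˣ) (r : F) : F :=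
  let v := colorAfter (word ns) o (topColor r)
  form (v (blockPos (ns.length - 1)).castSucc) (v (blockPos (ns.length - 1)).succ)

/-! ### Evaluation of the polynomial colorings at a number -/

lemma Crossing.color_comp {R S : Type*} [CommRing R] [CommRing S] (f : R →+* S) (c : Crossing)
    (d : Fin 4 → ℤˣ) (v : Fin 4 → Fin 2 → R) :
    c.color d (fun s i => f (v s i)) = fun s i => f (c.color d v s i) := by
  funext s i
  by_cases hl : s = c.l
  · subst hl
    cases hc : c.right
    · simp [Crossing.color_left_l hc, twist, form]
    · simp [Crossing.color_right_l hc]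
  by_cases hr : s = c.r
  · subst hr
    cases hc : c.right
    · simp [Crossing.color_left_r hc]
    · simp [Crossing.color_right_r hc, twist, form]
  · rw [c.color_of_ne _ _ hl hr, c.color_of_ne _ _ hl hr]

lemma colorAfter_comp {R S : Type*} [CommRing R] [CommRing S] (f : R →+* S)
    (w : List Crossing) (d : Fin 4 → ℤˣ) (v : Fin 4 → Fin 2 → R) :
    colorAfter w d (fun s i => f (v s i)) = fun s i => f (colorAfter w d v s i) := by
  induction w generalizing d v with
  | nil => rfl
  | cons c w ih => rw [colorAfter, colorAfter, c.color_comp, ih]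

lemma colorAfter_topColor_aeval (w : List Crossing) (o : Fin 4 → ℤˣ) (r : F) :
    colorAfter w o (topColor r) =
      fun s i => aeval r (colorAfter w o (topColor (X : ℤ[X])) s i) := by
  have h : topColor r = fun s i => (aeval r : ℤ[X] →ₐ[ℤ] F).toRingHom (topColor X s i) := by
    funext s i
    fin_cases s <;> fin_cases i <;> simp [topColor]
  rw [h, colorAfter_comp]
  rfl

lemma aeval_closingDet (ns : List ℤ) (o : Fin 4 → ℤˣ) (r : F) :
    aeval r (closingDet ns o) = closingForm ns o r := by
  simp only [closingDet, closingForm, colorAfter_topColor_aeval]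
  split_ifs <;> simp [form]

lemma aeval_repPoly_eq_zero_iff [CharZero F] (ns : List ℤ) (o : Fin 4 → ℤˣ) (r : F) :
    aeval r (repPoly ns o) = 0 ↔ closingForm ns o r = 0 := by
  rw [← aeval_closingDet, repPoly]
  by_cases h : closingDet ns o = 0
  · simp [h]
  · have hs : SignType.sign (closingDet ns o).leadingCoeff ≠ 0 := by simpa using h
    have hs' : algebraMap ℤ F (SignType.sign (closingDet ns o).leadingCoeff : ℤ) ≠ 0 := by
      revert hs
      generalize SignType.sign (closingDet ns o).leadingCoeff = x
      cases x <;> simp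
    rw [map_mul, aeval_C, mul_eq_zero, or_iff_right hs']

/-- Crossings preserve the determinant of their two strands, so `u_k` can be read below the last
block, where the upside-down diagram begins. -/
lemma aeval_uSeq {ns : List ℤ} (hne : ns ≠ []) (o : Fin 4 → ℤˣ) (r : F) :
    aeval r (uSeq ns o ns.length) = lastForm ns o r := by
  have hw : word ns = word (ns.take (ns.length - 1)) ++
      block (ns.length - 1) (ns.getLast hne) := by
    conv_lhs => rw [← List.dropLast_append_getLast hne]
    rw [word, wordFrom_append, List.dropLast_eq_take]
    simp [word, wordFrom]
  have h : aeval r (uSeq ns o ns.length) =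
      form (colorAfter (word (ns.take (ns.length - 1))) o (topColor r)
          (blockPos (ns.length - 1)).castSucc)
        (colorAfter (word (ns.take (ns.length - 1))) o (topColor r)
          (blockPos (ns.length - 1)).succ) := by
    simp only [uSeq, colorAfter_topColor_aeval]
    simp [form]
  rw [h, lastForm, hw, colorAfter_append]
  exact (form_colorAfter_replicate ⟨blockPos (ns.length - 1), _⟩ _ _ _).symm

/-- A linear map of determinant `±1` moving two independent vectors to the coordinate axes. -/
lemma exists_linearMap_form (e : ℤˣ) {x y : Fin 2 → F} (h : form x y ≠ 0) :
    ∃ g : (Fin 2 → F) →ₗ[F] (Fin 2 → F),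
      (∀ a b, form (g a) (g b) = ((e : ℤ) : F) * form a b) ∧
        g x = ![1, 0] ∧ g y = ![0, ((e : ℤ) : F) * form x y] := by
  refine ⟨{ toFun := fun a => ![form a y / form x y, ((e : ℤ) : F) * form x a]
            map_add' := ?_
            map_smul' := ?_ }, ?_, ?_, ?_⟩
  · intro a b
    ext i
    fin_cases i <;> simp [form] <;> ring
  · intro c a
    ext i
    fin_cases i <;> simp [form] <;> ring
  · intro a b
    simp only [LinearMap.coe_mk, AddHom.coe_mk]
    rw [form]
    simp only [Matrix.cons_val_zero, Matrix.cons_val_one]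
    field_simp
    simp only [form]
    ring
  · ext i
    fin_cases i <;> simp [h]
  · ext i
    fin_cases i <;> simp

/-- A coloring of a word whose top vectors agree in pairs up to sign is, up to a linear map, the
coloring with the standard vectors at the top. -/
lemma form_colorAfter_topColor {w : List Crossing} {d d' : Fin 4 → ℤˣ} (e : ℤˣ)
    (hd : ∀ s, d' s = e * d s) {p q : Fin 4 → Fin 2 → F} (h : SignEq (colorAfter w d p) q)
    (h1 : p 1 = p 0 ∨ p 1 = -p 0) (h3 : p 3 = p 2 ∨ p 3 = -p 2) (h0 : form (p 0) (p 2) ≠ 0)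
    {u : F} (hu : u = form (p 0) (p 2) ∨ u = -form (p 0) (p 2)) (s t : Fin 4) :
    form (colorAfter w d' (topColor u) s) (colorAfter w d' (topColor u) t) = form (q s) (q t) ∨
    form (colorAfter w d' (topColor u) s) (colorAfter w d' (topColor u) t) =
      -form (q s) (q t) := by
  obtain ⟨g, hg, hg0, hg2⟩ := exists_linearMap_form e h0
  have he : ((e : ℤ) : F) = 1 ∨ ((e : ℤ) : F) = -1 := by
    rcases Int.units_eq_one_or e with h | h <;> simp [h]
  have hu' : topColor u 2 = g (p 2) ∨ topColor u 2 = -g (p 2) := by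
    rw [hg2]
    rcases hu with hu | hu <;> rcases he with he | he <;> rw [hu, he] <;> simp [topColor]
  have htop : SignEq (topColor u) (fun s => g (p s)) := by
    intro s
    fin_cases s
    · exact Or.inl hg0.symm
    · rcases h1 with h1 | h1 <;> simp [h1, hg0, topColor]
    · exact hu'
    · change topColor u 2 = g (p 3) ∨ topColor u 2 = -g (p 3)
      rcases h3 with h3 | h3 <;> rw [h3]
      · exact hu'
      · rw [map_neg, neg_neg]
        exact hu'.symm
  have h2 := (htop.colorAfter w d').form s t
  rw [show d' = fun s => e * d s from funext hd, colorAfter_map w e g hg] at h2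
  rw [show d' = fun s => e * d s from funext hd]
  simp only [hg] at h2
  rcases h2 with h2 | h2 <;> rcases h.form s t with h4 | h4 <;> rcases he with he | he <;>
    simp [h2, h4, he]

/-- The position map between a diagram and the upside-down diagram. -/
def flipPos (k : ℕ) : Equiv.Perm (Fin 4) := if Odd k then 1 else Equiv.swap 0 2

lemma flipPos_mul_self (k : ℕ) : flipPos k * flipPos k = 1 := by
  unfold flipPos; split_ifs <;> simp

@[simp] lemma flipPos_flipPos (k : ℕ) (s : Fin 4) : flipPos k (flipPos k s) = s := by
  rw [← Equiv.Perm.mul_apply, flipPos_mul_self]; rfl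

lemma flipPos_bottomCap (k : ℕ) (s : Fin 4) :
    flipPos k (bottomCap k s) = topCap (flipPos k s) := by
  unfold flipPos bottomCap
  split_ifs
  · rfl
  · revert s; decide

lemma strandPerm_upsideDown (ns : List ℤ) :
    strandPerm (word (upsideDown ns)) =
      flipPos ns.length * (strandPerm (word ns))⁻¹ * flipPos ns.length := by
  by_cases h : Odd ns.length
  · rw [word_upsideDown_of_odd h, flipPos, if_pos h]
    simpa using strandPerm_map_reverse (σ := 1) (by simp) id (word ns) (by simp)
  · rw [word_upsideDown_of_even (Nat.not_odd_iff_even.1 h), flipPos, if_neg h]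
    exact strandPerm_map_reverse (by simp) _ _ fun c hc =>
      c.flip_swap (left_ne_two_of_mem_wordFrom 0 ns c hc)

/-- An orientation of the upside-down diagram of a knot is, up to a global sign, the reversed
orientation of the diagram. -/
lemma IsOrientation.upsideDown {ns : List ℤ} (hK : IsKnot ns) {o o' : Fin 4 → ℤˣ}
    (ho : IsOrientation ns o) (ho' : IsOrientation (upsideDown ns) o') :
    ∃ e : ℤˣ, ∀ s, o' s = e * -o (strandPerm (word ns) (flipPos ns.length s)) := by
  set π := strandPerm (word ns) with hπ
  set σ := flipPos ns.length with hσ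
  have hinv (s) : π⁻¹ (π s) = s := by simp
  -- Both orientations change sign across every arc, so their product does not, and on a knot it is
  -- constant.
  have hc := apply_eq_of_isKnot hK (f := fun s => o s * o' (σ (π⁻¹ s))) ?_ ?_
  · refine ⟨-(o 0 * o' (σ (π⁻¹ 0))), fun s => ?_⟩
    have := hc 0 (π (σ s))
    simp only [hinv] at this
    rw [this, hσ, flipPos_flipPos, ← hσ]
    rcases Int.units_eq_one_or (o (π (σ s))) with h | h <;> rw [h] <;> simp
  · intro s
    have h := ho'.2 (σ s)
    rw [strandPerm_upsideDown, length_upsideDown, ← hπ, ← hσ] at h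
    have hb : σ (bottomCap ns.length (σ s)) = topCap s := by
      rw [hσ, flipPos_bottomCap, flipPos_flipPos]
    simp only [Equiv.Perm.mul_apply, hb] at h
    rw [hσ, flipPos_flipPos, ← hσ] at h
    simp only [ho.1, h]
    simp
  · intro s
    have h := ho'.1 (σ s)
    rw [hσ, ← flipPos_bottomCap, ← hσ] at h
    have h2 := ho.2 s
    simp only [← hπ] at h2
    simp only [← hπ, hinv]
    rw [h, h2]
    simp

/-- The coloring of the upside-down diagram which starts with the bottom vectors of the diagram:
if the vectors at the bottom match, then it ends with the top vectors. -/
theorem upsideDown_coloring {ns : List ℤ} (hne : ns ≠ []) {o : Fin 4 → ℤˣ}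
    (ho : IsOrientation ns o) {r : F} (hr : r ≠ 0) (hroot : closingForm ns o r = 0)
    {o' : Fin 4 → ℤˣ} (e : ℤˣ)
    (ho' : ∀ s, o' s = e * -o (strandPerm (word ns) (flipPos ns.length s))) :
    lastForm ns o r ≠ 0 ∧ closingForm (upsideDown ns) o' (lastForm ns o r) = 0 ∧
      (lastForm (upsideDown ns) o' (lastForm ns o r) = r ∨
        lastForm (upsideDown ns) o' (lastForm ns o r) = -r) := by
  have hcap := signEq_bottomCap ho hr hroot
  have hn := not_form_eq_zero (ns := ns) o hr
  set v := colorAfter (word ns) o (topColor r) with hv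
  have hdb (s) : o (strandPerm (word ns) (bottomCap ns.length s)) =
    -o (strandPerm (word ns) s) := ho.2 s
  have hw := left_ne_two_of_mem_wordFrom 0 ns
  have hlen : 1 ≤ ns.length := List.length_pos_iff.2 hne
  by_cases hk : Odd ns.length
  · have hb : bottomCap ns.length = Equiv.swap 0 1 * Equiv.swap 2 3 := by simp [bottomCap, hk]
    have hp : blockPos (ns.length - 1) = 1 := by
      have : Even (ns.length - 1) := by grind
      simp [blockPos, this]
    rw [hb] at hcap hdb
    have h1 : v 1 = v 0 ∨ v 1 = -v 0 := hcap 0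
    have h3 : v 3 = v 2 ∨ v 3 = -v 2 := hcap 2
    have hu : lastForm ns o r = form (v 0) (v 2) ∨ lastForm ns o r = -form (v 0) (v 2) := by
      have : lastForm ns o r = form (v 1) (v 2) := by simp only [lastForm, hp]; rfl
      rw [this]
      rcases h1 with h | h <;> rw [h] <;> simp
    -- The bottom arcs pair strands with equal vectors up to sign and opposite directions, so all
    -- twists in `backColor` cancel or act trivially; the same holds at the top.
    have hback : backColor (fun s => o (strandPerm (word ns) s)) v = v := by
      have e1 : o (strandPerm (word ns) 1) = -o (strandPerm (word ns) 0) := hdb 0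
      funext s
      fin_cases s
      · rfl
      · rcases h1 with h1 | h1 <;> simp [backColor, h1]
      · rcases h1 with h1 | h1 <;> simp [backColor, h1, e1]
      · rcases h1 with h1 | h1 <;> rcases h3 with h3 | h3 <;> simp [backColor, h1, h3, e1]
    have htop : backColor o (topColor r) = topColor r := by
      have e1 : o 1 = -o 0 := ho.1 0
      have t1 : topColor r 1 = topColor r 0 := rfl
      have t3 : topColor r 3 = topColor r 2 := rfl
      funext s
      fin_cases s <;> simp [backColor, t1, t3, e1]
    -- Otherwise all bottom vectors would be parallel, hence all top vectors too, contradicting `r ≠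
    -- 0`.
    have hne0 : form (v 0) (v 2) ≠ 0 := by
      intro h0
      have h0' : form (v 2) (v 0) = 0 := by rw [form_swap, h0, neg_zero]
      apply hn
      intro s t
      fin_cases s <;> fin_cases t <;> rcases h1 with h1 | h1 <;> rcases h3 with h3 | h3 <;>
        simp [h1, h3, h0, h0']
    have hrev := colorAfter_map_reverse (σ := 1) (by simp) id backColor (word ns) (by simp)
      (fun c hc d v => c.backColor_color (hw c hc) d v) o (topColor r)
    rw [List.map_id, ← word_upsideDown_of_odd hk, ← hv, hback, htop] at hrev
    have key := form_colorAfter_topColor e (d' := o') (fun s => by simpa [flipPos, hk] using ho' s)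
      hrev h1 h3 hne0 hu
    refine ⟨by rcases hu with hu | hu <;> rw [hu] <;> simpa using hne0, ?_, ?_⟩
    · rw [closingForm, length_upsideDown, if_pos hk]
      rcases key 2 3 with h | h <;> rw [h] <;> simp [topColor, form]
    · rw [lastForm, length_upsideDown, hp]
      simpa [topColor, form] using key 1 2
  · have hb : bottomCap ns.length = Equiv.swap 0 3 * Equiv.swap 1 2 := by simp [bottomCap, hk]
    have hp : blockPos (ns.length - 1) = 0 := by
      have : ¬ Even (ns.length - 1) := by grind
      simp [blockPos, this]
    rw [hb] at hcap
    have h1 : v 1 = v 2 ∨ v 1 = -v 2 := hcap 2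
    have h3 : v 3 = v 0 ∨ v 3 = -v 0 := hcap 0
    have hu : lastForm ns o r = form (v 2) (v 0) ∨ lastForm ns o r = -form (v 2) (v 0) := by
      have : lastForm ns o r = form (v 0) (v 1) := by simp only [lastForm, hp]; rfl
      rw [this]
      rcases h1 with h | h <;> rw [h, form_swap] <;> simp
    have hne0 : form (v 2) (v 0) ≠ 0 := by
      intro h0
      have h0' : form (v 0) (v 2) = 0 := by rw [form_swap, h0, neg_zero]
      apply hn
      intro s t
      fin_cases s <;> fin_cases t <;> rcases h1 with h1 | h1 <;> rcases h3 with h3 | h3 <;>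
        simp [h1, h3, h0, h0']
    have hrev := colorAfter_map_reverse (σ := Equiv.swap 0 2) (by simp) Crossing.flip
      (fun _ v s => v (Equiv.swap 0 2 s)) (word ns) (fun c hc => c.flip_swap (hw c hc))
      (fun c hc d v => c.flipColor_color (hw c hc) d v) o (topColor r)
    rw [← word_upsideDown_of_even (Nat.not_odd_iff_even.1 hk), ← hv] at hrev
    have key := form_colorAfter_topColor e (d' := o') (fun s => by simpa [flipPos, hk] using ho' s)
      hrev h1 h3 hne0 hu
    refine ⟨by rcases hu with hu | hu <;> rw [hu] <;> simpa using hne0, ?_, ?_⟩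
    · rw [closingForm, length_upsideDown, if_neg hk]
      rcases key 0 3 with h | h <;> rw [h] <;>
        simp [topColor, form, Equiv.swap_apply_of_ne_of_ne]
    · rw [lastForm, length_upsideDown, hp]
      have := (key 0 1).symm
      simpa [topColor, form, Equiv.swap_apply_of_ne_of_ne] using this

end UpsideDown

/-! ### Representations and trace fields -/

lemma Crossing.map_conj {G H : Type*} [Group G] [Group H] (f : G →* H) (c : Crossing)
    (d : Fin 4 → ℤˣ) (g : Fin 4 → G) (s : Fin 4) :
    f (c.conj d g s) = c.conj d (fun s => f (g s)) s := by
  unfold Crossing.conj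
  split_ifs <;> simp only [Function.update_apply] <;> split_ifs <;> simp

lemma Crossing.conj_mem {G : Type*} [Group G] (H : Subgroup G) (c : Crossing)
    (d : Fin 4 → ℤˣ) {g : Fin 4 → G} (hg : ∀ s, g s ∈ H) (s : Fin 4) : c.conj d g s ∈ H := by
  unfold Crossing.conj
  split_ifs <;> simp only [Function.update_apply] <;> split_ifs <;> first
    | exact hg _
    | exact H.mul_mem (H.mul_mem (H.zpow_mem (hg _) _) (hg _)) (H.zpow_mem (hg _) _)

lemma coe_parabolic (x : Fin 2 → ℂ) : (parabolic x : Matrix (Fin 2) (Fin 2) ℂ) =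
    !![1 - x 0 * x 1, x 0 ^ 2; -x 1 ^ 2, 1 + x 0 * x 1] := rfl

@[simp] lemma parabolic_neg (x : Fin 2 → ℂ) : parabolic (-x) = parabolic x := by
  apply Subtype.ext
  simp [parabolic]

/-- `parabolic x` is the matrix of the transvection along `x`, so this is `twist_conj` in matrix
form; it turns colorings into solutions of the Wirtinger relations. -/
lemma parabolic_twist (e : ℤˣ) (x y : Fin 2 → ℂ) :
    parabolic (twist e x y) =
      parabolic x ^ (e : ℤ) * parabolic y * parabolic x ^ (-(e : ℤ)) := by
  have h1 (y) : parabolic (twist 1 x y) = parabolic x * parabolic y * (parabolic x)⁻¹ := by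
    rw [eq_mul_inv_iff_mul_eq]
    ext i j
    simp only [Matrix.SpecialLinearGroup.coe_mul, coe_parabolic, twist, form]
    fin_cases i <;> fin_cases j <;> simp [Matrix.mul_apply, Fin.sum_univ_two] <;> ring
  rcases Int.units_eq_one_or e with rfl | rfl
  · simpa using h1 y
  · have h2 := h1 (twist (-1) x y)
    rw [twist_twist_neg] at h2
    rw [h2]
    simp [mul_assoc]

lemma parabolic_color (c : Crossing) (d : Fin 4 → ℤˣ) (v : Fin 4 → Fin 2 → ℂ) (s : Fin 4) :
    parabolic (c.color d v s) = c.conj d (fun s => parabolic (v s)) s := by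
  by_cases hl : s = c.l
  · subst hl
    cases hc : c.right
    · rw [Crossing.color_left_l hc, parabolic_neg, parabolic_twist]
      simp [Crossing.conj, hc]
    · rw [Crossing.color_right_l hc]
      simp [Crossing.conj, hc, c.l_ne_r]
  by_cases hr : s = c.r
  · subst hr
    cases hc : c.right
    · rw [Crossing.color_left_r hc]
      simp [Crossing.conj, hc, c.l_ne_r.symm]
    · rw [Crossing.color_right_r hc, parabolic_neg, parabolic_twist]
      simp [Crossing.conj, hc]
  · rw [c.color_of_ne d v hl hr]
    unfold Crossing.conj
    split_ifs <;> simp [hl, hr]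

lemma parabolic_colorAfter_mem (H : Subgroup (Matrix.SpecialLinearGroup (Fin 2) ℂ))
    (w : List Crossing) (d : Fin 4 → ℤˣ) {v : Fin 4 → Fin 2 → ℂ}
    (hv : ∀ s, parabolic (v s) ∈ H) : ∀ s, parabolic (colorAfter w d v s) ∈ H := by
  induction w generalizing d v with
  | nil => exact hv
  | cons c w ih =>
    exact ih _ fun s => by rw [parabolic_color]; exact c.conj_mem H d hv s

lemma trace_parabolic_mul (x y : Fin 2 → ℂ) :
    Matrix.trace ((parabolic x * parabolic y : Matrix.SpecialLinearGroup (Fin 2) ℂ) :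
      Matrix (Fin 2) (Fin 2) ℂ) = 2 - form x y ^ 2 := by
  rw [Matrix.SpecialLinearGroup.coe_mul, coe_parabolic, coe_parabolic, form]
  simp [Matrix.trace_fin_two]
  ring

lemma colorAfter_take_succ {R : Type*} [CommRing R] (w : List Crossing) (t : Fin w.length)
    (d : Fin 4 → ℤˣ) (v : Fin 4 → Fin 2 → R) :
    colorAfter (w.take (t + 1)) d v =
      (w.get t).color (fun s => d (strandPerm (w.take t) s)) (colorAfter (w.take t) d v) := by
  rw [List.take_add_one, List.getElem?_eq_getElem t.2, colorAfter_append]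
  rfl

/-- The matrix of an arc in the coloring with `⟨a, b⟩ = r`. -/
def arcMatrix (ns : List ℤ) (o : Fin 4 → ℤˣ) (r : ℂ) (g : Gen ns) :
    Matrix.SpecialLinearGroup (Fin 2) ℂ :=
  parabolic (colorAfter ((word ns).take g.1) o (topColor r) g.2)

/-- A root of the closing determinant gives a representation of the knot group. -/
theorem exists_isColoringRep {ns : List ℤ} {o : Fin 4 → ℤˣ} (ho : IsOrientation ns o) {r : ℂ}
    (hr : r ≠ 0) (h : closingForm ns o r = 0) : ∃ ρ, IsColoringRep ns o r ρ := by
  have hf : ∀ x ∈ wirtingerRels ns o, FreeGroup.lift (arcMatrix ns o r) x = 1 := by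
    rintro x ((⟨t, s, rfl⟩ | ⟨s, rfl⟩) | ⟨s, rfl⟩)
    · rw [map_mul, map_inv, mul_inv_eq_one, Crossing.map_conj]
      simp only [FreeGroup.lift_apply_of]
      rw [arcMatrix, Fin.val_succ, colorAfter_take_succ, parabolic_color]
      rfl
    · rw [map_mul, map_inv, mul_inv_eq_one, FreeGroup.lift_apply_of, FreeGroup.lift_apply_of]
      exact congrArg parabolic (topColor_topCap r s)
    · rw [map_mul, map_inv, mul_inv_eq_one, FreeGroup.lift_apply_of, FreeGroup.lift_apply_of,
        arcMatrix, arcMatrix, Fin.val_last, List.take_length]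
      -- The sign ambiguity is harmless because `x` and `-x` have the same matrix.
      rcases signEq_bottomCap ho hr h s with h | h <;> simp only at h <;> rw [h]
      exact parabolic_neg _
  exact ⟨PresentedGroup.toGroup hf, fun g => PresentedGroup.toGroup.of hf⟩

lemma aeval_mem_adjoin (x : ℂ) (p : ℤ[X]) : aeval x p ∈ IntermediateField.adjoin ℚ {x} := by
  rw [aeval_eq_sum_range]
  exact sum_mem fun i _ => zsmul_mem (pow_mem (IntermediateField.mem_adjoin_simple_self ℚ x) i) _

/-! ### The trace field in terms of the root -/

section TraceField

variable {ns : List ℤ} {o : Fin 4 → ℤˣ} {r : ℂ}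
  {ρ : KnotGroup ns o →* Matrix.SpecialLinearGroup (Fin 2) ℂ}

lemma form_sq_mem_traceField (hρ : IsColoringRep ns o r ρ)
    (t : Fin ((word ns).length + 1)) (i j : Fin 4) :
    form (colorAfter ((word ns).take t) o (topColor r) i)
      (colorAfter ((word ns).take t) o (topColor r) j) ^ 2 ∈ traceField ρ := by
  have h : (2 : ℂ) - Matrix.trace ((ρ (PresentedGroup.of (t, i) * PresentedGroup.of (t, j)) :
      Matrix.SpecialLinearGroup (Fin 2) ℂ) : Matrix (Fin 2) (Fin 2) ℂ) ∈ traceField ρ :=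
    sub_mem (ofNat_mem _ 2) (IntermediateField.subset_adjoin _ _ ⟨_, rfl⟩)
  rw [map_mul, hρ, hρ, trace_parabolic_mul, sub_sub_cancel] at h
  exact h

/-- The trace field of the representation at the root `r` is `ℚ(r²)`. -/
theorem traceField_eq (hρ : IsColoringRep ns o r ρ) :
    traceField ρ = IntermediateField.adjoin ℚ {r ^ 2} := by
  apply le_antisymm
  · set K := IntermediateField.adjoin ℚ {r ^ 2}
    let a : K := ⟨r ^ 2, IntermediateField.mem_adjoin_simple_self ℚ _⟩
    let H := (Matrix.SpecialLinearGroup.map (n := Fin 2) (algebraMap K ℂ)).range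
    -- The two bridge matrices have entries in `ℚ(r²)`, and all arc matrices arise from them by
    -- conjugation.
    have htop (s) : parabolic (topColor r s) ∈ H := by
      have h0 : parabolic ![1, 0] ∈ H := by
        refine ⟨⟨!![1, 1; 0, 1], by simp⟩, ?_⟩
        ext i j
        change algebraMap K ℂ ((!![1, 1; 0, 1] : Matrix (Fin 2) (Fin 2) K) i j) = _
        rw [coe_parabolic]
        fin_cases i <;> fin_cases j <;> simp
      have h2 : parabolic ![0, r] ∈ H := by
        refine ⟨⟨!![1, 0; -a, 1], by simp⟩, ?_⟩
        ext i j
        change algebraMap K ℂ ((!![1, 0; -a, 1] : Matrix (Fin 2) (Fin 2) K) i j) = _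
        rw [coe_parabolic]
        fin_cases i <;> fin_cases j <;> simp [a]
      fin_cases s
      exacts [h0, h0, h2, h2]
    have hH : ∀ γ, ρ γ ∈ H := by
      intro γ
      have : Subgroup.closure (Set.range (PresentedGroup.of (rels := wirtingerRels ns o))) ≤
          H.comap ρ := by
        rw [Subgroup.closure_le]
        rintro _ ⟨g, rfl⟩
        change ρ (PresentedGroup.of g) ∈ H
        rw [hρ g]
        exact parabolic_colorAfter_mem H _ _ htop _
      rw [PresentedGroup.closure_range_of] at this
      exact this (Subgroup.mem_top γ)
    rw [traceField, IntermediateField.adjoin_le_iff]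
    rintro _ ⟨γ, rfl⟩
    obtain ⟨M, hM⟩ := hH γ
    simp only [← hM, Matrix.trace_fin_two]
    exact add_mem (SetLike.coe_mem _) (SetLike.coe_mem _)
  · rw [IntermediateField.adjoin_simple_le_iff]
    -- Height 0 and strands 0 and 2 are the two bridges, whose determinant is `r`.
    simpa [colorAfter, topColor, form] using form_sq_mem_traceField hρ 0 0 2

lemma lastForm_sq_mem (hρ : IsColoringRep ns o r ρ) :
    lastForm ns o r ^ 2 ∈ IntermediateField.adjoin ℚ {r ^ 2} := by
  rw [← traceField_eq hρ]
  simpa [lastForm] using form_sq_mem_traceField hρ (Fin.last _)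
    (blockPos (ns.length - 1)).castSucc (blockPos (ns.length - 1)).succ

end TraceField

end TwoBridge

end

theorem corollary5p3 (ns : List ℤ) (hne : ns ≠ []) (hns : ∀ n ∈ ns, n ≠ 0)
    (hK : TwoBridge.IsKnot ns)
    (o : Fin 4 → ℤˣ) (ho : TwoBridge.IsOrientation ns o)
    (r : ℂ) (hr : r ≠ 0) (hroot : Polynomial.aeval r (TwoBridge.repPoly ns o) = 0) :
    -- `ℚ(r) = ℚ(u_k(r))`
    IntermediateField.adjoin ℚ {r} =
        IntermediateField.adjoin ℚ
          {Polynomial.aeval r (TwoBridge.uSeq ns o ns.length)} ∧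
      -- `u_k(r)` is a non-zero root of the rep-polynomial of the upside-down diagram,
      -- and the corresponding representations have the same trace field
      ∀ o' : Fin 4 → ℤˣ, TwoBridge.IsOrientation (TwoBridge.upsideDown ns) o' →
        Polynomial.aeval r (TwoBridge.uSeq ns o ns.length) ≠ 0 ∧
        Polynomial.aeval (Polynomial.aeval r (TwoBridge.uSeq ns o ns.length))
            (TwoBridge.repPoly (TwoBridge.upsideDown ns) o') = 0 ∧
        ∃ (ρ : TwoBridge.KnotGroup ns o →* Matrix.SpecialLinearGroup (Fin 2) ℂ)
          (ρ' : TwoBridge.KnotGroup (TwoBridge.upsideDown ns) o' →*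
            Matrix.SpecialLinearGroup (Fin 2) ℂ),
          TwoBridge.IsColoringRep ns o r ρ ∧
          TwoBridge.IsColoringRep (TwoBridge.upsideDown ns) o'
            (Polynomial.aeval r (TwoBridge.uSeq ns o ns.length)) ρ' ∧
          TwoBridge.traceField ρ = TwoBridge.traceField ρ' := by
  rw [TwoBridge.aeval_repPoly_eq_zero_iff] at hroot
  rw [TwoBridge.aeval_uSeq hne]
  constructor
  · have hmem : TwoBridge.lastForm ns o r ∈ IntermediateField.adjoin ℚ {r} := by
      rw [← TwoBridge.aeval_uSeq hne]
      exact TwoBridge.aeval_mem_adjoin _ _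
    have hmem' : r ∈ IntermediateField.adjoin ℚ {TwoBridge.lastForm ns o r} := by
      -- No orientation of `K'` is given here, so the reversed one, with `e = 1`, is used.
      obtain ⟨-, -, h⟩ := TwoBridge.upsideDown_coloring hne ho hr hroot 1 (fun _ => rfl)
      have hm := TwoBridge.aeval_mem_adjoin (TwoBridge.lastForm ns o r)
        (TwoBridge.uSeq (TwoBridge.upsideDown ns)
          (fun s => 1 * -o (TwoBridge.strandPerm (TwoBridge.word ns)
            (TwoBridge.flipPos ns.length s))) (TwoBridge.upsideDown ns).length)
      rw [TwoBridge.aeval_uSeq (TwoBridge.upsideDown_ne_nil hne)] at hm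
      rcases h with h | h <;> rw [h] at hm
      · exact hm
      · exact neg_mem_iff.1 hm
    exact le_antisymm (IntermediateField.adjoin_simple_le_iff.2 hmem')
      (IntermediateField.adjoin_simple_le_iff.2 hmem)
  · intro o' ho'
    obtain ⟨e, he⟩ := ho.upsideDown hK ho'
    obtain ⟨hu, hu0, hur⟩ := TwoBridge.upsideDown_coloring hne ho hr hroot e he
    obtain ⟨ρ, hρ⟩ := TwoBridge.exists_isColoringRep ho hr hroot
    obtain ⟨ρ', hρ'⟩ := TwoBridge.exists_isColoringRep ho' hu hu0
    refine ⟨hu, (TwoBridge.aeval_repPoly_eq_zero_iff _ _ _).2 hu0, ρ, ρ', hρ, hρ', ?_⟩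
    rw [TwoBridge.traceField_eq hρ, TwoBridge.traceField_eq hρ']
    have h := TwoBridge.lastForm_sq_mem hρ'
    have hr2 : TwoBridge.lastForm (TwoBridge.upsideDown ns) o' (TwoBridge.lastForm ns o r) ^ 2 =
        r ^ 2 := by rcases hur with h | h <;> simp [h]
    rw [hr2] at h
    exact le_antisymm (IntermediateField.adjoin_simple_le_iff.2 h)
      (IntermediateField.adjoin_simple_le_iff.2 (TwoBridge.lastForm_sq_mem hρ))
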